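/- Given a graph $H$ and $r \in \mathbb{N}$, the \emph{$r$th power} of $H$ is the graph obtained from $H$ by adding an edge between every pair of distinct vertices at distance at most $r$ in $H$. Given $\rho, d > 0$, an $n$-vertex graph $G$ is called \emph{$(\rho,d)$-dense} if every $X \subseteq V(G)$ satisfies $e(G[X]) \geq d\binom{|X|}{2} - \rho n^2$, where $e(G[X])$ is the number of edges of the subgraph of $G$ induced by $X$. For all $r, s \in \mathbb{N}$ and all real $d, \eta > 0$ there exist $\rho > 0$ and $n_0 > 0$ such that every $(\rho,d)$-dense (finite, simple) graph $G$ on $n \geq n_0$ vertices with minimum degree $\delta(G) \geq (1/2+\eta)n$ contains, as a not necessarily induced subgraph, the $r$th power of a Hamilton cycle (a cycle through all $n$ vertices). In fact, for every $n' \in \mathbb{N}$ with $n - s \leq n' \leq n$, $G$ contains the $r$th power of a cycle covering precisely $n'$ vertices. -/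

import Mathlib

/-- The `r`-th power of a graph `H`: add to `H` an edge between every pair of distinct vertices at
distance at most `r` in `H`. Vertices in different components have extended distance `⊤`. -/
def graphPower {V : Type*} (H : SimpleGraph V) (r : ℕ) : SimpleGraph V where
  Adj u v := H.Adj u v ∨ (u ≠ v ∧ H.edist u v ≤ (r : ℕ∞))
  symm := ⟨fun _ _ h => h.imp (fun h => h.symm)
    (fun h => ⟨h.1.symm, by rw [SimpleGraph.edist_comm]; exact h.2⟩)⟩
  loopless := ⟨fun _ h => h.elim (fun h => h.ne rfl) (fun h => h.1 rfl)⟩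

/-- A graph `G` on `n` vertices is `(ρ, d)`-dense if every set `X` of vertices satisfies
`e(G[X]) ≥ d * (|X| choose 2) - ρ * n ^ 2`. -/
def IsLocallyDense {V : Type*} [Fintype V] (G : SimpleGraph V) (ρ d : ℝ) : Prop :=
  ∀ X : Finset V,
    d * (X.card.choose 2 : ℝ) - ρ * (Fintype.card V : ℝ) ^ 2 ≤
      ((G.induce (X : Set V)).edgeSet.ncard : ℝ)

/-! Local density is used only to find cliques: in a locally dense graph every set of linear size
contains a clique of any fixed size (`exists_clique_of_isLocallyDense`). The rest needs only this
and the minimum degree.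

A maximal packing by disjoint `t`-cliques `Q i` leaves a small set `U`. Degrees above `n / 2` give
many vertices substantial neighbourhoods in both of two given cliques, so pigeonhole
(`exists_common_neighbors`) yields `r` exit vertices `B i` in `Q i` and `r` entry vertices `A (i +
1)` in `Q (i + 1)` with linearly many common neighbours. Among these there is an `r`-clique `Z i`,
and `B i, Z i, A (i + 1)` bridges the two cliques. The bridges use few vertices. Each vertex left in
`U` still has `2 r` neighbours in the interior of many cliques, so distinct cliques can be assigned
to these vertices, and each is inserted into its own clique (`exists_insertion`). Closing the chain
of cliques cyclically gives the Hamilton cycle power (`exists_cyclic_powPath`).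

Shorter cycles come from deleting at most `s` vertices: minimum degree and the clique property
survive with slightly worse constants. -/

/-! ### Lists that are powers of paths -/

/-- Consecutive entries of the list, up to distance `r`, are adjacent. -/
def IsPowPath {V : Type*} (G : SimpleGraph V) (r : ℕ) : List V → Prop
  | [] => True
  | x :: l => (∀ y ∈ l.take r, G.Adj x y) ∧ IsPowPath G r l

namespace IsPowPath

variable {V : Type*} {G : SimpleGraph V} {r : ℕ}

theorem of_pairwise : ∀ {l : List V}, l.Pairwise G.Adj → IsPowPath G r l
  | [], _ => trivial
  | _ :: _, h =>
    ⟨fun y hy => (List.pairwise_cons.1 h).1 y (List.mem_of_mem_take hy),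
      of_pairwise (List.pairwise_cons.1 h).2⟩

/-- An entry of `l` and an entry of `l'` are separated by all of `C`, hence more than `r` apart, so
every adjacency required is already seen on one side. -/
theorem glue {l C l' : List V} (hC : r ≤ C.length) (h : IsPowPath G r (l ++ C))
    (h' : IsPowPath G r (C ++ l')) : IsPowPath G r (l ++ (C ++ l')) := by
  induction l with
  | nil => simpa using h'
  | cons x l ih =>
    refine ⟨fun y hy => h.1 y ?_, ih h.2⟩
    change y ∈ (l ++ (C ++ l')).take r at hy
    rwa [← List.append_assoc, List.take_append_of_le_length (by simp; omega)] at hy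

theorem adj : ∀ {l : List V}, IsPowPath G r l → ∀ {i j : ℕ} (_ : i < j) (hj : j < l.length),
    j ≤ i + r → G.Adj (l[i]'(by omega)) l[j]
  | [], _, _, _, _, hj, _ => absurd hj (by simp)
  | x :: l, h, 0, j + 1, _, hj, hr => by
    have hj' : j < l.length := by simpa using hj
    refine h.1 _ (List.mem_take_iff_getElem.2 ⟨j, by omega, ?_⟩)
    simp
  | x :: l, h, i + 1, j + 1, hij, hj, hr => by
    have hj' : j < l.length := by simpa using hj
    exact adj h.2 (i := i) (j := j) (by omega) hj' (by omega)

/-- Blocks that start with the `r` vertices in which the previous block leads. -/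
theorem flatMap_range {S T : ℕ → List V} (hS : ∀ i, r ≤ (S i).length)
    (h0 : IsPowPath G r (S 0))
    (h : ∀ i, IsPowPath G r (S i ++ (T i ++ S (i + 1)))) (n : ℕ) :
    IsPowPath G r ((List.range n).flatMap (fun i => S i ++ T i) ++ S n) := by
  induction n with
  | zero => simpa using h0
  | succ n ih =>
    have := glue (hS n) ih (h n)
    simpa [List.range_succ, List.append_assoc] using this

end IsPowPath

/-! ### From cyclic lists to powers of cycles -/

/-- Each step of a walk moves by `±1` modulo `n`. This turns the distance bound in the cycle into
arithmetic on list positions. -/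
theorem exists_int_of_walk_cycleGraph {n : ℕ} {u v : Fin n}
    (p : (SimpleGraph.cycleGraph n).Walk u v) :
    ∃ z : ℤ, |z| ≤ p.length ∧ ∃ q : ℤ, (v : ℤ) = u + z + q * n := by
  induction p with
  | nil => exact ⟨0, by simp, 0, by simp⟩
  | @cons u v w h p ih =>
    obtain ⟨z, hz, q, hq⟩ := ih
    have key : ∃ y : ℤ, |y| ≤ 1 ∧ ∃ q : ℤ, (v : ℤ) = u + y + q * n := by
      have hu := u.isLt
      have hv := v.isLt
      rw [SimpleGraph.cycleGraph_adj', Fin.sub_def, Fin.sub_def] at h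
      rcases h with h | h
      -- Subtraction in `Fin n` reduces `n - v + u` modulo `n`; the quotient, corrected by the extra
      -- `n`, counts the turns.
      · refine ⟨-1, by simp, 1 - (((n - v + u) / n : ℕ) : ℤ), ?_⟩
        have h1 := Nat.div_add_mod (n - v + u) n
        rw [show (n - v + u) % n = 1 from h] at h1
        have h2 : (n : ℤ) * (((n - v + u) / n : ℕ) : ℤ) + 1 = n - v + u := by
          rw [← Nat.cast_sub hv.le]; exact_mod_cast h1
        linarith only [h2]
      · refine ⟨1, by simp, (((n - u + v) / n : ℕ) : ℤ) - 1, ?_⟩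
        have h1 := Nat.div_add_mod (n - u + v) n
        rw [show (n - u + v) % n = 1 from h] at h1
        have h2 : (n : ℤ) * (((n - u + v) / n : ℕ) : ℤ) + 1 = n - u + v := by
          rw [← Nat.cast_sub hu.le]; exact_mod_cast h1
        linarith only [h2]
    obtain ⟨y, hy, q', hq'⟩ := key
    refine ⟨y + z, ?_, q + q', by rw [hq, hq']; ring⟩
    have := abs_add_le y z
    simp only [SimpleGraph.Walk.length_cons]
    push_cast
    linarith

/-- Appending `l.take r` encodes the wrap-around: the entry at position `v < r` reappears at
position `v + l.length`. -/
theorem IsPowPath.isContained_graphPower_cycleGraph {V : Type*} {G : SimpleGraph V} {r : ℕ}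
    {l : List V} (hl : l.Nodup) (hr : 1 ≤ r) (hrl : r ≤ l.length)
    (h : IsPowPath G r (l ++ l.take r)) :
    (graphPower (SimpleGraph.cycleGraph l.length) r).IsContained G := by
  have fwd : ∀ (u v : Fin l.length) (z : ℕ), u ≠ v → z ≤ r →
      (∃ q : ℤ, (v : ℤ) = u + z + q * l.length) → G.Adj l[u] l[v] := by
    rintro u v z huv hz ⟨q, hq⟩
    have hu := u.isLt
    have hv := v.isLt
    have huv' : (u : ℕ) ≠ v := fun h => huv (Fin.ext h)
    have hq1 : q < 1 := by
      by_contra hc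
      have : (l.length : ℤ) ≤ q * l.length := by nlinarith
      omega
    have hq2 : -2 < q := by
      by_contra hc
      have : q * (l.length : ℤ) ≤ -2 * l.length := by nlinarith
      omega
    -- Either no wrap-around, or exactly one, in which case `v` is read in the appended copy.
    have hcases : q = 0 ∨ q = -1 := by omega
    rcases hcases with rfl | rfl
    · have := h.adj (i := u) (j := v) (by omega) (by simp; omega) (by omega)
      rwa [List.getElem_append_left hu, List.getElem_append_left hv] at this
    · have := h.adj (i := u) (j := v + l.length) (by omega) (by simp; omega) (by omega)
      rw [List.getElem_append_left hu, List.getElem_append_right (by omega)] at this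
      simpa using this
  have main : ∀ u v : Fin l.length, u ≠ v →
      (SimpleGraph.cycleGraph l.length).edist u v ≤ (r : ℕ∞) → G.Adj l[u] l[v] := by
    intro u v huv hd
    have hne : (SimpleGraph.cycleGraph l.length).edist u v ≠ ⊤ :=
      ne_top_of_le_ne_top (ENat.natCast_ne_top r) hd
    obtain ⟨p, hp⟩ := (SimpleGraph.edist_ne_top_iff_reachable.1 hne).exists_walk_length_eq_edist
    rw [← hp] at hd
    have hd' : p.length ≤ r := by exact_mod_cast hd
    obtain ⟨z, hz, q, hq⟩ := exists_int_of_walk_cycleGraph p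
    rcases le_total 0 z with h0 | h0
    · rw [abs_of_nonneg h0] at hz
      exact fwd u v z.toNat huv (by omega) ⟨q, by rw [Int.toNat_of_nonneg h0]; exact hq⟩
    · rw [abs_of_nonpos h0] at hz
      refine (fwd v u (-z).toNat huv.symm (by omega) ⟨-q, ?_⟩).symm
      rw [Int.toNat_of_nonneg (by omega), hq]
      ring
  refine ⟨⟨⟨fun i => l[i], ?_⟩, ?_⟩⟩
  · rintro u v (h | ⟨huv, hd⟩)
    · exact main u v h.ne ((SimpleGraph.edist_le_one_iff_adj_or_eq.2 (Or.inl h)).trans (by exact_mod_cast hr))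
    · exact main u v huv hd
  · intro i j hij
    exact Fin.ext ((List.Nodup.getElem_inj_iff hl).1 hij)

theorem graphPower_mono {V : Type*} (H : SimpleGraph V) {r s : ℕ} (h : r ≤ s) :
    graphPower H r ≤ graphPower H s := by
  rintro u v (h' | ⟨h1, h2⟩)
  · exact Or.inl h'
  · exact Or.inr ⟨h1, h2.trans (by exact_mod_cast h)⟩

/-! ### Disjoint families, distinct representatives, double counting -/

/-- Greedy choice: `N` bounds the vertices of `F₀` and of all sets chosen so far. -/
theorem exists_pairwiseDisjoint_family {ι α : Type*} [DecidableEq α]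
    (good : ι → Finset α → Prop) (r N : ℕ) (F₀ : Finset α) (I : Finset ι)
    (hN : F₀.card + r * I.card ≤ N)
    (h : ∀ i ∈ I, ∀ F : Finset α, F.card ≤ N → ∃ Z, good i Z ∧ Z.card = r ∧ Disjoint Z F) :
    ∃ Z : ι → Finset α, (∀ i ∈ I, good i (Z i) ∧ (Z i).card = r ∧ Disjoint (Z i) F₀) ∧
      (I : Set ι).PairwiseDisjoint Z := by
  classical
  induction I using Finset.induction_on with
  | empty => exact ⟨fun _ => ∅, by simp, by simp⟩
  | insert a s ha ih =>
    rw [Finset.card_insert_of_notMem ha, mul_add] at hN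
    obtain ⟨Z, hZ, hd⟩ := ih (by omega) (fun i hi => h i (Finset.mem_insert_of_mem hi))
    obtain ⟨Y, hY, hYr, hYd⟩ := h a (Finset.mem_insert_self a s) (F₀ ∪ s.biUnion Z) (by
      have h1 := Finset.card_union_le F₀ (s.biUnion Z)
      have h2 : (s.biUnion Z).card ≤ s.card * r :=
        Finset.card_biUnion_le_card_mul _ _ _ (fun i hi => (hZ i hi).2.1.le)
      rw [mul_comm] at h2
      omega)
    rw [Finset.disjoint_union_right, Finset.disjoint_biUnion_right] at hYd
    have hne : ∀ i ∈ s, i ≠ a := fun i hi h => ha (h ▸ hi)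
    refine ⟨Function.update Z a Y, ?_, ?_⟩
    · intro i hi
      rcases Finset.mem_insert.1 hi with rfl | hi
      · simpa using ⟨hY, hYr, hYd.1⟩
      · rw [Function.update_of_ne (hne i hi)]
        exact hZ i hi
    · rw [Finset.coe_insert, Set.pairwiseDisjoint_insert_of_notMem (by simpa using ha)]
      refine ⟨?_, ?_⟩
      · intro i hi j hj hij
        have := hd hi hj hij
        simpa [Function.onFun, Function.update_of_ne (hne i hi),
          Function.update_of_ne (hne j hj)] using this
      · intro j hj
        rw [Function.update_self, Function.update_of_ne (hne j hj)]
        exact hYd.2 j hj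

theorem exists_maximal_packing {α : Type*} [Fintype α] [DecidableEq α] (p : Finset α → Prop)
    (hp : ∀ Q, p Q → Q.Nonempty) :
    ∃ 𝒬 : Finset (Finset α), (∀ Q ∈ 𝒬, p Q) ∧ (𝒬 : Set (Finset α)).PairwiseDisjoint id ∧
      ∀ Q, p Q → ¬ Disjoint Q (𝒬.biUnion id) := by
  classical
  let S : Finset (Finset (Finset α)) := Finset.univ.filter fun 𝒬 =>
    (∀ Q ∈ 𝒬, p Q) ∧ (𝒬 : Set (Finset α)).PairwiseDisjoint id
  obtain ⟨𝒬, h𝒬, hmax⟩ := S.exists_max_image Finset.card ⟨∅, by simp [S]⟩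
  simp only [S, Finset.mem_filter, Finset.mem_univ, true_and] at h𝒬 hmax
  refine ⟨𝒬, h𝒬.1, h𝒬.2, fun Q hQ hd => ?_⟩
  rw [Finset.disjoint_biUnion_right] at hd
  have hQn : Q ∉ 𝒬 := fun hmem => by
    have := hd Q hmem
    simp only [id, disjoint_self] at this
    exact (hp Q hQ).ne_empty this
  have := hmax (insert Q 𝒬) ⟨by simpa using ⟨hQ, h𝒬.1⟩, by
    rw [Finset.coe_insert, Set.pairwiseDisjoint_insert_of_notMem (by simpa using hQn)]
    exact ⟨h𝒬.2, fun j hj => hd j hj⟩⟩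
  rw [Finset.card_insert_of_notMem hQn] at this
  omega

/-- Hall's condition is immediate, since a single list of options is already as large as the whole
index set. -/
theorem exists_injective_of_card_le {ι α : Type*} [Fintype ι] [DecidableEq α]
    (opt : ι → Finset α) (h : ∀ i, Fintype.card ι ≤ (opt i).card) :
    ∃ f : ι → α, Function.Injective f ∧ ∀ i, f i ∈ opt i := by
  refine (Finset.all_card_le_biUnion_card_iff_exists_injective opt).1 fun s => ?_
  rcases s.eq_empty_or_nonempty with rfl | ⟨i, hi⟩
  · simp
  · exact (Finset.card_le_univ s).trans
      ((h i).trans (Finset.card_le_card (Finset.subset_biUnion_of_mem opt hi)))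

theorem sum_card_neighborFinset_inter {V : Type*} [Fintype V] [DecidableEq V] (G : SimpleGraph V)
    [DecidableRel G.Adj] (P : Finset V) :
    ∑ v, (G.neighborFinset v ∩ P).card = ∑ p ∈ P, G.degree p := by
  have : ∀ v, (G.neighborFinset v ∩ P).card = (P.filter (fun p => G.Adj v p)).card := by
    intro v
    congr 1
    ext p
    simp [and_comm]
  simp_rw [this, Finset.card_filter]
  rw [Finset.sum_comm]
  refine Finset.sum_congr rfl fun p _ => ?_
  rw [← Finset.card_filter, ← SimpleGraph.card_neighborFinset_eq_degree]
  congr 1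
  ext v
  simp [G.adj_comm]

/-! ### Common neighbours and cliques -/

/-- If all degrees exceed `(1 / 2 + η) n`, any two `k`-sets contain `r`-sets with a linear number of
common neighbours. -/
theorem exists_common_neighbors {V : Type*} [Fintype V] [DecidableEq V] (G : SimpleGraph V)
    [DecidableRel G.Adj] {r k : ℕ} {η : ℝ} (hk : (r : ℝ) ≤ η * k) (hk0 : 0 < k) (hrk : r ≤ k)
    (hdeg : ∀ v, (1 / 2 + η) * Fintype.card V ≤ G.degree v) {P R : Finset V}
    (hP : P.card = k) (hR : R.card = k) :
    ∃ P' ⊆ P, ∃ R' ⊆ R, P'.card = r ∧ R'.card = r ∧ ∃ X : Finset V,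
      η / (2 * (k.choose r : ℝ) ^ 2) * Fintype.card V ≤ X.card ∧
      ∀ x ∈ X, (∀ p ∈ P', G.Adj p x) ∧ ∀ p ∈ R', G.Adj x p := by
  classical
  set n := Fintype.card V with hn
  let good : Finset V := Finset.univ.filter fun v =>
    r ≤ (G.neighborFinset v ∩ P).card ∧ r ≤ (G.neighborFinset v ∩ R).card
  have hgood : η / 2 * n ≤ good.card := by
    -- A vertex that is not good has fewer than `r` neighbours in `P` or in `R`, so it contributes
    -- at most `k + r`. The degrees force a total of at least `(1 + 2 η) k n`, and `r ≤ η k` leaves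
    -- `η k n` for the good vertices to supply.
    have hle : ∀ v, ((G.neighborFinset v ∩ P).card : ℝ) + (G.neighborFinset v ∩ R).card ≤
        k + r + if v ∈ good then (k : ℝ) else 0 := by
      intro v
      have h1 : (G.neighborFinset v ∩ P).card ≤ k := hP ▸ Finset.card_le_card Finset.inter_subset_right
      have h2 : (G.neighborFinset v ∩ R).card ≤ k := hR ▸ Finset.card_le_card Finset.inter_subset_right
      split_ifs with h
      · have : (G.neighborFinset v ∩ P).card + (G.neighborFinset v ∩ R).card ≤ k + r + k := by omega
        exact_mod_cast this
      · have : (G.neighborFinset v ∩ P).card + (G.neighborFinset v ∩ R).card ≤ k + r + 0 := by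
          simp only [good, Finset.mem_filter, Finset.mem_univ, true_and] at h
          omega
        exact_mod_cast this
    have hsum := Finset.sum_le_sum (fun v (_ : v ∈ Finset.univ) => hle v)
    rw [Finset.sum_add_distrib, Finset.sum_add_distrib, ← Nat.cast_sum, ← Nat.cast_sum,
      sum_card_neighborFinset_inter, sum_card_neighborFinset_inter, Finset.sum_const,
      Finset.card_univ, Finset.sum_ite_mem, Finset.univ_inter, Finset.sum_const] at hsum
    have hdP : ∀ S : Finset V, S.card = k →
        k * ((1 / 2 + η) * n) ≤ ((∑ p ∈ S, G.degree p : ℕ) : ℝ) := by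
      intro S hS
      rw [Nat.cast_sum, ← hS, ← nsmul_eq_mul]
      exact Finset.card_nsmul_le_sum _ _ _ (fun p _ => hdeg p)
    have h1 := hdP P hP
    have h2 := hdP R hR
    simp only [nsmul_eq_mul] at hsum
    rw [← hn] at hsum
    have hk0' : (0 : ℝ) < k := by exact_mod_cast hk0
    have hn0 : (0 : ℝ) ≤ n := Nat.cast_nonneg n
    have h3 : (n : ℝ) * r ≤ n * (η * k) := mul_le_mul_of_nonneg_left hk hn0
    have h4 : k * (η * n) ≤ k * (good.card : ℝ) := by linarith
    have h5 := le_of_mul_le_mul_left h4 hk0'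
    have hr0 : 0 ≤ (good.card : ℝ) := Nat.cast_nonneg _
    linarith
  have hf : ∀ v ∈ good, ∃ p : Finset V × Finset V, p.1 ⊆ G.neighborFinset v ∩ P ∧ p.1.card = r ∧
      p.2 ⊆ G.neighborFinset v ∩ R ∧ p.2.card = r := by
    intro v hv
    simp only [good, Finset.mem_filter, Finset.mem_univ, true_and] at hv
    obtain ⟨A, hA, hAr⟩ := Finset.exists_subset_card_eq hv.1
    obtain ⟨B, hB, hBr⟩ := Finset.exists_subset_card_eq hv.2
    exact ⟨(A, B), hA, hAr, hB, hBr⟩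
  choose! f hf using hf
  let T := P.powersetCard r ×ˢ R.powersetCard r
  have hT : T.card = k.choose r ^ 2 := by
    simp [T, Finset.card_product, hP, hR, sq]
  have hpos : (0 : ℝ) < (k.choose r : ℝ) ^ 2 := by
    have := Nat.choose_pos hrk
    positivity
  have hTn : T.Nonempty := by
    rw [← Finset.card_pos, hT]; exact_mod_cast hpos
  -- Pigeonhole over the `(k.choose r) ^ 2` pairs of `r`-subsets.
  obtain ⟨⟨P', R'⟩, hPR, hc⟩ := Finset.exists_le_card_fiber_of_nsmul_le_card_of_maps_to
    (s := good) (t := T) (f := f) (b := η / (2 * (k.choose r : ℝ) ^ 2) * n) (fun v hv => by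
      simp only [T, Finset.mem_product, Finset.mem_powersetCard]
      obtain ⟨h1, h2, h3, h4⟩ := hf v hv
      exact ⟨⟨h1.trans Finset.inter_subset_right, h2⟩, h3.trans Finset.inter_subset_right, h4⟩) hTn
    (by
      rw [hT, nsmul_eq_mul]
      refine le_trans (le_of_eq ?_) hgood
      have hne : (k.choose r : ℝ) ≠ 0 := fun h => by simp [h] at hpos
      push_cast
      field_simp)
  simp only [T, Finset.mem_product, Finset.mem_powersetCard] at hPR
  refine ⟨P', hPR.1.1, R', hPR.2.1, hPR.1.2, hPR.2.2, _, hc, ?_⟩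
  intro x hx
  rw [Finset.mem_filter] at hx
  obtain ⟨h1, -, h3, -⟩ := hf x hx.1
  rw [hx.2] at h1 h3
  refine ⟨fun p hp => ?_, fun p hp => ?_⟩
  · exact ((G.mem_neighborFinset x p).1 (Finset.mem_of_mem_inter_left (h1 hp))).symm
  · exact (G.mem_neighborFinset x p).1 (Finset.mem_of_mem_inter_left (h3 hp))

/-- Large sets in a locally dense graph contain large cliques. -/
theorem exists_clique_of_isLocallyDense (d : ℝ) (hd : 0 < d) (t : ℕ) (γ : ℝ) (hγ : 0 < γ) :
    ∃ ρ : ℝ, 0 < ρ ∧ ∃ n₀ : ℕ, ∀ (V : Type*) [Fintype V] (G : SimpleGraph V),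
      n₀ ≤ Fintype.card V → IsLocallyDense G ρ d →
      ∀ X : Finset V, γ * Fintype.card V ≤ X.card → ∃ Q ⊆ X, G.IsNClique t Q := by
  induction t generalizing γ with
  | zero => exact ⟨1, one_pos, 0, fun V _ G _ _ X _ => ⟨∅, by simp, by simp⟩⟩
  | succ t ih =>
    obtain ⟨ρ₁, hρ₁, n₁, h₁⟩ := ih (d * γ / 2) (by positivity)
    -- If all degrees in `G[X]` were below `d γ n / 2`, their sum would be at most `d |X|² / 2`,
    -- while the error `2 ρ n²` is at most `d |X|² / 4`; density then forces `|X| ≤ 4`. The bound `5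
    -- / γ` on `n` excludes this.
    refine ⟨min ρ₁ (d * γ ^ 2 / 8), by positivity, max (max n₁ 1) ⌈5 / γ⌉₊, ?_⟩
    intro V _ G hn hG X hX
    classical
    set ρ := min ρ₁ (d * γ ^ 2 / 8) with hρ
    set n := Fintype.card V with hnV
    have hn1 : n₁ ≤ n := (le_max_left _ _).trans ((le_max_left _ _).trans hn)
    have hn0 : 1 ≤ n := (le_max_right _ _).trans ((le_max_left _ _).trans hn)
    have hn2 : 5 / γ ≤ n := (Nat.le_ceil _).trans (by exact_mod_cast (le_max_right _ _).trans hn)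
    rw [div_le_iff₀ hγ] at hn2
    have hn0' : (1 : ℝ) ≤ n := by exact_mod_cast hn0
    have hX5 : (5 : ℝ) ≤ X.card := by linarith
    set H := G.induce (X : Set V) with hH
    have hcard : Fintype.card (X : Set V) = X.card := by simp
    have hdense := hG X
    have hedge : (H.edgeSet.ncard : ℝ) = H.edgeFinset.card := by
      rw [← SimpleGraph.coe_edgeFinset, Set.ncard_coe_finset]
    rw [← hH, hedge, ← hnV, Nat.cast_choose_two] at hdense
    have hsum : ((∑ v, H.degree v : ℕ) : ℝ) = 2 * H.edgeFinset.card := by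
      exact_mod_cast H.sum_degrees_eq_twice_card_edges
    have hex : ∃ v : (X : Set V), d * γ / 2 * n ≤ H.degree v := by
      by_contra! hcon
      have hle : ((∑ v, H.degree v : ℕ) : ℝ) ≤ X.card * (d * γ / 2 * n) := by
        rw [Nat.cast_sum, ← hcard, ← nsmul_eq_mul, ← Finset.card_univ]
        exact Finset.sum_le_card_nsmul _ _ _ (fun v _ => (hcon v).le)
      have h1 : ρ * n ^ 2 ≤ d * γ ^ 2 / 8 * n ^ 2 :=
        mul_le_mul_of_nonneg_right (min_le_right _ _) (by positivity)
      have h2 : (γ * n) * (γ * n) ≤ X.card * X.card :=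
        mul_le_mul hX hX (by positivity) (by positivity)
      have h3 : X.card * (γ * n) ≤ X.card * X.card :=
        mul_le_mul_of_nonneg_left hX (by positivity)
      have h4 : 5 * (X.card : ℝ) ≤ X.card * X.card :=
        mul_le_mul_of_nonneg_right hX5 (by positivity)
      have h5 : 0 < d * ((X.card : ℝ) * X.card - 4 * X.card) := mul_pos hd (by linarith)
      have h6 := mul_le_mul_of_nonneg_left h2 hd.le
      have h7 := mul_le_mul_of_nonneg_left h3 hd.le
      rw [hsum] at hle
      linarith
    obtain ⟨v, hv⟩ := hex
    -- Induction inside the neighbourhood of `v` in `X`, to which `v` is then added.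
    obtain ⟨Q, hQ, hQc⟩ := h₁ V G hn1 (fun Y => (by
      have := hG Y
      have h1 : ρ * n ^ 2 ≤ ρ₁ * (n : ℝ) ^ 2 :=
        mul_le_mul_of_nonneg_right (min_le_left _ _) (by positivity)
      linarith)) ((H.neighborFinset v).map (Function.Embedding.subtype _)) (by
        rw [Finset.card_map, SimpleGraph.card_neighborFinset_eq_degree]; exact hv)
    have hQ' : ∀ q ∈ Q, G.Adj v q ∧ q ∈ X := by
      intro q hq
      obtain ⟨w, hw, rfl⟩ := Finset.mem_map.1 (hQ hq)
      exact ⟨by simpa [hH] using hw, w.2⟩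
    refine ⟨insert (v : V) Q, ?_, hQc.insert fun q hq => (hQ' q hq).1⟩
    intro x hx
    rcases Finset.mem_insert.1 hx with rfl | hx
    · exact v.2
    · exact (hQ' x hx).2

/-! ### Ordering cliques and inserting vertices -/

theorem SimpleGraph.IsClique.isPowPath {V : Type*} {G : SimpleGraph V} {s : Set V}
    (hs : G.IsClique s) (r : ℕ) {l : List V} (hl : l.Nodup) (hls : ∀ x ∈ l, x ∈ s) :
    IsPowPath G r l :=
  .of_pairwise (hl.pairwise_of_forall_ne fun _ ha _ hb hab => hs (hls _ ha) (hls _ hb) hab)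

theorem isPowPath_toList_append_toList {V : Type*} [DecidableEq V] {G : SimpleGraph V} {A B : Finset V}
    (hA : G.IsClique (A : Set V)) (hB : G.IsClique (B : Set V))
    (hAB : ∀ a ∈ A, ∀ b ∈ B, G.Adj a b) (r : ℕ) :
    IsPowPath G r (A.toList ++ B.toList) := by
  have := G.symm
  have hcl : G.IsClique ((A : Set V) ∪ B) :=
    Set.pairwise_union_of_symm.2 ⟨hA, hB, fun a ha b hb _ => hAB a ha b hb⟩
  refine hcl.isPowPath r ?_ (by simp)
  simp only [List.nodup_append', Finset.nodup_toList, List.disjoint_left, Finset.mem_toList,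
    true_and]
  exact fun x hx hx' => G.irrefl (hAB x hx x hx')

/-- A vertex with `2 r` neighbours inside a clique can be inserted into an ordering of it. -/
theorem exists_insertion {V : Type*} [DecidableEq V] {G : SimpleGraph V} {r : ℕ}
    {A M B : Finset V} (hcl : G.IsClique ((A ∪ M ∪ B : Finset V) : Set V)) (hAM : Disjoint A M)
    (hAB : Disjoint A B) (hMB : Disjoint M B) {v : V} (hv : v ∉ A ∪ M ∪ B) {S : Finset V}
    (hS : S ⊆ M) (hvS : ∀ x ∈ S, G.Adj v x) (hSr : 2 * r ≤ S.card) :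
    ∃ mid : List V, mid.Nodup ∧ (∀ x, x ∈ mid ↔ x ∈ M ∨ x = v) ∧
      IsPowPath G r (A.toList ++ (mid ++ B.toList)) := by
  obtain ⟨N₁, hN₁, hN₁r⟩ := Finset.exists_subset_card_eq (show r ≤ S.card by omega)
  have hN₂r : r ≤ (S \ N₁).card := by
    rw [Finset.card_sdiff_of_subset hN₁]; omega
  simp only [Finset.mem_union, not_or] at hv
  have hN₁M := hN₁.trans hS
  have hAM' := Finset.disjoint_left.1 hAM
  have hAB' := Finset.disjoint_left.1 hAB
  have hMB' := Finset.disjoint_left.1 hMB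
  -- The order is `A, M \ S, N₁, v, S \ N₁, B`: at least `r` neighbours of `v` stand on each side of
  -- it, and they also serve as the overlaps for gluing.
  have key : IsPowPath G r ((A.toList ++ (M \ S).toList) ++
      (N₁.toList ++ (v :: ((S \ N₁).toList ++ B.toList)))) := by
    refine IsPowPath.glue (by simp [hN₁r]) ?_ ?_
    · refine hcl.isPowPath r ?_ ?_
      · simp only [List.nodup_append', Finset.nodup_toList, List.disjoint_left, Finset.mem_toList,
          List.mem_append, Finset.mem_sdiff]
        grind
      · simp only [List.mem_append, Finset.mem_toList, Finset.coe_union, Set.mem_union,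
          Finset.mem_coe, Finset.mem_sdiff]
        grind
    · have : IsPowPath G r ((N₁.toList ++ [v]) ++ ((S \ N₁).toList ++ B.toList)) := by
        refine IsPowPath.glue (by simpa using hN₂r) ?_ ?_
        · have hcl' : G.IsClique (insert v (S : Set V)) := by
            refine (hcl.subset ?_).insert fun x hx _ => hvS x hx
            intro x hx
            have := hS hx
            simp [this]
          refine hcl'.isPowPath r ?_ ?_
          · simp only [List.nodup_append', Finset.nodup_toList, List.disjoint_left,
              Finset.mem_toList, List.mem_append, Finset.mem_sdiff, List.nodup_singleton,
              List.mem_singleton]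
            grind
          · simp only [List.mem_append, Finset.mem_toList, Set.mem_insert_iff,
              Finset.mem_coe, Finset.mem_sdiff, List.mem_singleton]
            grind
        · refine hcl.isPowPath r ?_ ?_
          · simp only [List.nodup_append', Finset.nodup_toList, List.disjoint_left,
              Finset.mem_toList, Finset.mem_sdiff]
            grind
          · simp only [List.mem_append, Finset.mem_toList, Finset.coe_union, Set.mem_union,
              Finset.mem_coe, Finset.mem_sdiff]
            grind
      simpa using this
  refine ⟨(M \ S).toList ++ (N₁.toList ++ (v :: (S \ N₁).toList)), ?_, ?_, by simpa using key⟩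
  · simp only [List.nodup_append', Finset.nodup_toList, List.disjoint_left, Finset.mem_toList,
      List.mem_append, Finset.mem_sdiff, List.nodup_cons, List.mem_cons]
    grind
  · simp only [Finset.mem_toList, List.mem_append, Finset.mem_sdiff, List.mem_cons]
    grind

/-! ### Closing up and assembling the cycle -/

/-- Blocks indexed cyclically, each leading in the first `r` vertices of the next one. -/
theorem exists_cyclic_powPath_of_blocks {V : Type*} {G : SimpleGraph V} {r m : ℕ} [NeZero m]
    (A T : ZMod m → List V) (hAr : ∀ i, (A i).length = r) (hA : IsPowPath G r (A 0))
    (hpath : ∀ i, IsPowPath G r (A i ++ (T i ++ A (i + 1)))) (hnodup : ∀ i, (A i ++ T i).Nodup)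
    (hdisj : ∀ i j, i ≠ j → ∀ x ∈ A i ++ T i, x ∉ A j ++ T j)
    (hcover : ∀ x, ∃ i, x ∈ A i ++ T i) :
    ∃ l : List V, l.Nodup ∧ (∀ v, v ∈ l) ∧ r ≤ l.length ∧ IsPowPath G r (l ++ l.take r) := by
  obtain ⟨l, hl⟩ : ∃ l, l = (List.range m).flatMap fun j : ℕ => A j ++ T j := ⟨_, rfl⟩
  -- Since `m = 0` in `ZMod m`, the block after the last one is the first.
  have htake : l.take r = A m := by
    obtain ⟨m', hm'⟩ := Nat.exists_eq_succ_of_ne_zero (NeZero.ne m)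
    have : List.range m = 0 :: (List.range m').map Nat.succ := by
      rw [hm', List.range_succ_eq_map]
    rw [hl, this, List.flatMap_cons, List.append_assoc]
    simpa using List.take_left' (hAr 0)
  refine ⟨l, ?_, ?_, ?_, ?_⟩
  · rw [hl, List.nodup_flatMap]
    refine ⟨fun j _ => hnodup j, List.pairwise_lt_range.imp_of_mem ?_⟩
    intro a b ha hb hab
    have hne : (a : ZMod m) ≠ b := by
      intro h
      rw [ZMod.natCast_eq_natCast_iff'] at h
      rw [List.mem_range] at ha hb
      rw [Nat.mod_eq_of_lt ha, Nat.mod_eq_of_lt hb] at h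
      omega
    exact fun x hxa hxb => hdisj a b hne x hxa hxb
  · intro x
    obtain ⟨i, hi⟩ := hcover x
    rw [hl, List.mem_flatMap]
    refine ⟨i.val, List.mem_range.2 (ZMod.val_lt i), ?_⟩
    rwa [ZMod.natCast_zmod_val]
  · have := hAr m
    rw [← htake, List.length_take] at this
    omega
  · rw [htake, hl]
    refine IsPowPath.flatMap_range (S := fun j : ℕ => A j) (T := fun j : ℕ => T j)
      (fun j => (hAr j).ge) (by simpa using hA) (fun j => ?_) m
    simpa using hpath j

set_option maxHeartbeats 1000000 in
/-- Minimum degree above half and cliques in all linear-size sets: the cliques of a packing can be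
joined cyclically, with the uncovered vertices inserted into them. -/
theorem exists_cyclic_powPath (r : ℕ) (hr : 1 ≤ r) (η : ℝ) (hη : 0 < η) :
    ∃ (t : ℕ) (γ : ℝ), 0 < γ ∧ ∀ (V : Type*) [Fintype V] [Nonempty V] (G : SimpleGraph V)
      [DecidableRel G.Adj],
      (∀ v, (1 / 2 + η) * Fintype.card V ≤ G.degree v) →
      (∀ X : Finset V, γ * Fintype.card V ≤ X.card → ∃ Q ⊆ X, G.IsNClique t Q) →
      ∃ l : List V, l.Nodup ∧ (∀ v, v ∈ l) ∧ r ≤ l.length ∧ IsPowPath G r (l ++ l.take r) := by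
  obtain ⟨k, hk, hrk⟩ : ∃ k : ℕ, (r : ℝ) ≤ η * k ∧ r ≤ k := by
    refine ⟨⌈r / η⌉₊ + r, ?_, by omega⟩
    have := Nat.le_ceil ((r : ℝ) / η)
    rw [div_le_iff₀ hη] at this
    push_cast
    nlinarith [mul_nonneg hη.le (Nat.cast_nonneg (α := ℝ) r)]
  obtain ⟨c, hc⟩ : ∃ c : ℝ, c = η / (2 * (k.choose r : ℝ) ^ 2) := ⟨_, rfl⟩
  have hc0 : 0 < c := by
    have := Nat.choose_pos hrk
    rw [hc]
    positivity
  -- `2 k ≤ t` leaves room for disjoint entry and exit reservoirs in a clique; `6 r ≤ c t` makes the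
  -- at most `3 r m` forbidden vertices at most half of each common neighbourhood; `40 r ≤ t` makes
  -- the bridges negligible in the degree count.
  obtain ⟨t, htk, htc, htr⟩ : ∃ t : ℕ, 2 * k ≤ t ∧ 6 * (r : ℝ) ≤ c * t ∧ 40 * r ≤ t := by
    refine ⟨2 * k + ⌈6 * r / c⌉₊ + 40 * r, by omega, ?_, by omega⟩
    have := Nat.le_ceil (6 * (r : ℝ) / c)
    rw [div_le_iff₀ hc0] at this
    push_cast
    nlinarith [mul_nonneg hc0.le (Nat.cast_nonneg (α := ℝ) r),
      mul_nonneg hc0.le (Nat.cast_nonneg (α := ℝ) k)]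
  have ht0 : (0 : ℝ) < t := by exact_mod_cast (show 0 < t by omega)
  -- `c / 2` allows a clique in what remains of a common neighbourhood; `1 / (4 t)` bounds the
  -- leftover vertices by the number of cliques available to each.
  refine ⟨t, min (c / 2) (1 / (4 * t)), by positivity, ?_⟩
  intro V _ _ G _ hdeg hclq
  classical
  set γ := min (c / 2) (1 / (4 * (t : ℝ))) with hγ
  set n := Fintype.card V with hn
  have hn0 : (0 : ℝ) < n := by exact_mod_cast Fintype.card_pos
  have hγc : γ ≤ c / 2 := min_le_left _ _
  have hγt : γ * (4 * t) ≤ 1 := by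
    have := min_le_right (c / 2) (1 / (4 * (t : ℝ)))
    rwa [← hγ, le_div_iff₀ (by positivity)] at this
  have ht40 : (40 : ℝ) * r ≤ t := by exact_mod_cast htr
  have hr1 : (1 : ℝ) ≤ r := by exact_mod_cast hr
  have hγ8 : γ ≤ 1 / 8 := by
    have : 0 < γ := by positivity
    nlinarith
  obtain ⟨𝒬, h𝒬, h𝒬d, h𝒬max⟩ := exists_maximal_packing (fun Q : Finset V => G.IsNClique t Q)
    (fun Q hQ => by rw [← Finset.card_pos, hQ.card_eq]; omega)
  have hU : ((Finset.univ \ 𝒬.biUnion id : Finset V).card : ℝ) ≤ γ * n := by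
    by_contra! hcon
    obtain ⟨Q, hQ, hQc⟩ := hclq _ hcon.le
    exact h𝒬max Q hQc (Finset.disjoint_of_subset_left hQ Finset.sdiff_disjoint)
  obtain ⟨m, hm⟩ : ∃ m, m = 𝒬.card := ⟨_, rfl⟩
  have hm0 : NeZero m := by
    refine ⟨fun h0 => ?_⟩
    rw [hm, Finset.card_eq_zero] at h0
    obtain ⟨Q, -, hQc⟩ := hclq Finset.univ (by
      rw [Finset.card_univ, ← hn]; nlinarith)
    exact h𝒬max Q hQc (by simp [h0])
  have hmt : (m : ℝ) * t ≤ n := by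
    have h1 : (𝒬.biUnion id).card = m * t := by
      rw [Finset.card_biUnion h𝒬d, hm]
      exact Finset.sum_const_nat fun Q hQ => (h𝒬 Q hQ).card_eq
    have h2 := Finset.card_le_univ (𝒬.biUnion id)
    rw [h1] at h2
    exact_mod_cast h2
  have hmr : (m : ℝ) * (40 * r) ≤ n :=
    (mul_le_mul_of_nonneg_left ht40 (Nat.cast_nonneg m)).trans hmt
  have e : ZMod m ≃ 𝒬 := Fintype.equivOfCardEq (by rw [ZMod.card, Fintype.card_coe, hm])
  obtain ⟨Q, hQ⟩ : ∃ Q : ZMod m → Finset V, ∀ i, Q i = (e i : Finset V) := ⟨_, fun _ => rfl⟩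
  have hQc : ∀ i, G.IsNClique t (Q i) := fun i => hQ i ▸ h𝒬 _ (e i).2
  have hQd : ∀ i j, i ≠ j → Disjoint (Q i) (Q j) := fun i j hij => by
    rw [hQ, hQ]
    exact h𝒬d (e i).2 (e j).2 fun h => hij (e.injective (Subtype.ext h))
  have hQU : ∀ x, x ∉ Finset.univ \ 𝒬.biUnion id → ∃ i, x ∈ Q i := by
    intro x hx
    simp only [Finset.mem_sdiff, Finset.mem_univ, true_and, not_not, Finset.mem_biUnion, id] at hx
    obtain ⟨C, hC, hxC⟩ := hx
    exact ⟨e.symm ⟨C, hC⟩, by rw [hQ]; simpa using hxC⟩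
  have hPR : ∀ i, ∃ P R : Finset V, P ⊆ Q i ∧ R ⊆ Q i ∧ Disjoint P R ∧ P.card = k ∧ R.card = k := by
    intro i
    obtain ⟨P, hP, hPk⟩ := Finset.exists_subset_card_eq (show k ≤ (Q i).card by
      rw [(hQc i).card_eq]; omega)
    obtain ⟨R, hR, hRk⟩ := Finset.exists_subset_card_eq (show k ≤ (Q i \ P).card by
      rw [Finset.card_sdiff_of_subset hP, (hQc i).card_eq]; omega)
    exact ⟨P, R, hP, hR.trans Finset.sdiff_subset,
      Finset.disjoint_of_subset_right hR Finset.disjoint_sdiff, hPk, hRk⟩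
  choose P R hPQ hRQ hPRd hPk hRk using hPR
  choose B hBP A' hA'R hBr hA'r X hX hXadj using fun i : ZMod m =>
    exists_common_neighbors G hk (by omega) hrk hdeg (hPk i) (hRk (i + 1))
  rw [← hc] at hX
  -- Entry sets were chosen with the bridge leaving clique `i`; they are reindexed by the clique in
  -- which they lie.
  obtain ⟨A, hA⟩ : ∃ A : ZMod m → Finset V, ∀ i, A i = A' (i - 1) := ⟨_, fun _ => rfl⟩
  have hAR : ∀ i, A i ⊆ R i := fun i => by simpa [hA] using hA'R (i - 1)
  have hAQ : ∀ i, A i ⊆ Q i := fun i => (hAR i).trans (hRQ i)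
  have hBQ : ∀ i, B i ⊆ Q i := fun i => (hBP i).trans (hPQ i)
  have hAB : ∀ i, Disjoint (A i) (B i) := fun i =>
    Finset.disjoint_of_subset_left (hAR i) (Finset.disjoint_of_subset_right (hBP i) (hPRd i).symm)
  have hAr : ∀ i, (A i).card = r := fun i => by rw [hA, hA'r]
  have hXA : ∀ i, ∀ x ∈ X i, ∀ p ∈ A (i + 1), G.Adj x p := fun i x hx p hp =>
    (hXadj i x hx).2 p (by simpa [hA] using hp)
  obtain ⟨E, hE⟩ : ∃ E : Finset V, E = Finset.univ.biUnion fun i => A i ∪ B i := ⟨_, rfl⟩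
  have hEc : E.card ≤ m * (2 * r) := by
    rw [hE]
    refine (Finset.card_biUnion_le_card_mul _ _ (2 * r) fun i _ => ?_).trans (by
      rw [Finset.card_univ, ZMod.card])
    have := Finset.card_union_le (A i) (B i)
    rw [hAr, hBr] at this
    omega
  obtain ⟨Z, hZ, hZd⟩ := exists_pairwiseDisjoint_family
    (fun (i : ZMod m) Z => Z ⊆ X i ∧ G.IsClique (Z : Set V)) r (m * (2 * r) + r * m) E Finset.univ
    (by rw [Finset.card_univ, ZMod.card]; omega) (by
      intro i _ F hF
      have h1 : γ * n ≤ ((X i \ F).card : ℝ) := by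
        have h2 : ((X i).card : ℝ) ≤ (X i \ F).card + F.card := by
          exact_mod_cast Finset.card_le_card_sdiff_add_card
        have h3 : (F.card : ℝ) ≤ m * (2 * r) + r * m := by exact_mod_cast hF
        have h4 : (m : ℝ) * (6 * r) ≤ c * n := by
          calc (m : ℝ) * (6 * r) ≤ m * (c * t) := mul_le_mul_of_nonneg_left htc (Nat.cast_nonneg m)
            _ = c * (m * t) := by ring
            _ ≤ c * n := mul_le_mul_of_nonneg_left hmt hc0.le
        have h5 : γ * n ≤ c / 2 * n := mul_le_mul_of_nonneg_right hγc hn0.le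
        have h6 := hX i
        linarith
      obtain ⟨C, hC, hCc⟩ := hclq _ h1
      obtain ⟨Z, hZ, hZr⟩ := Finset.exists_subset_card_eq (show r ≤ C.card by
        rw [hCc.card_eq]; omega)
      exact ⟨Z, ⟨(hZ.trans hC).trans Finset.sdiff_subset, hCc.isClique.subset (by simpa using hZ)⟩,
        hZr, Finset.disjoint_of_subset_left (hZ.trans hC) Finset.sdiff_disjoint⟩)
  obtain ⟨ZZ, hZZ⟩ : ∃ ZZ : Finset V, ZZ = Finset.univ.biUnion Z := ⟨_, rfl⟩
  have hZZc : ZZ.card ≤ m * r := by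
    rw [hZZ]
    exact (Finset.card_biUnion_le_card_mul _ _ r fun i _ => (hZ i (Finset.mem_univ i)).2.1.le).trans
      (by rw [Finset.card_univ, ZMod.card])
  have hmemZZ : ∀ x, x ∈ ZZ ↔ ∃ i, x ∈ Z i := by simp [hZZ]
  have hEZ : ∀ x ∈ E, x ∉ ZZ := by
    intro x hx hxZ
    obtain ⟨i, hi⟩ := (hmemZZ x).1 hxZ
    exact Finset.disjoint_left.1 (hZ i (Finset.mem_univ i)).2.2 hi hx
  have hAE : ∀ i, ∀ x ∈ A i, x ∈ E := fun i x hx => by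
    rw [hE]; exact Finset.mem_biUnion.2 ⟨i, Finset.mem_univ i, Finset.mem_union_left _ hx⟩
  have hBE : ∀ i, ∀ x ∈ B i, x ∈ E := fun i x hx => by
    rw [hE]; exact Finset.mem_biUnion.2 ⟨i, Finset.mem_univ i, Finset.mem_union_right _ hx⟩
  -- The bridging cliques may use vertices of any `Q i` or of `U`, so `ZZ` is removed both from the
  -- interiors and from the leftover set `W`.
  obtain ⟨M, hM⟩ : ∃ M : ZMod m → Finset V, ∀ i, M i = Q i \ (A i ∪ B i ∪ ZZ) := ⟨_, fun _ => rfl⟩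
  obtain ⟨U, hUdef⟩ : ∃ U : Finset V, U = Finset.univ \ 𝒬.biUnion id := ⟨_, rfl⟩
  rw [← hUdef] at hU hQU
  have hUQ : ∀ x ∈ U, ∀ i, x ∉ Q i := by
    intro x hx i hi
    rw [hQ] at hi
    rw [hUdef, Finset.mem_sdiff] at hx
    exact hx.2 (Finset.mem_biUnion.2 ⟨_, (e i).2, hi⟩)
  obtain ⟨W, hW⟩ : ∃ W : Finset V, W = U \ ZZ := ⟨_, rfl⟩
  obtain ⟨f, hfinj, hf⟩ := exists_injective_of_card_le (ι := W)
    (fun v => Finset.univ.filter fun i : ZMod m => 2 * r ≤ (G.neighborFinset (v : V) ∩ M i).card) (by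
      intro v
      obtain ⟨O, hO⟩ : ∃ O : Finset (ZMod m), O = Finset.univ.filter fun i : ZMod m =>
        2 * r ≤ (G.neighborFinset (v : V) ∩ M i).card := ⟨_, rfl⟩
      rw [← hO, Fintype.card_coe]
      have hcov : G.neighborFinset (v : V) ⊆
          ((U ∪ E) ∪ ZZ) ∪ Finset.univ.biUnion fun i => G.neighborFinset (v : V) ∩ M i := by
        intro x hx
        by_cases hxU : x ∈ U
        · simp [hxU]
        by_cases hxE : x ∈ E
        · simp [hxE]
        by_cases hxZ : x ∈ ZZ
        · simp [hxZ]
        obtain ⟨i, hi⟩ := hQU x hxU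
        refine Finset.mem_union_right _ (Finset.mem_biUnion.2 ⟨i, Finset.mem_univ i,
          Finset.mem_inter.2 ⟨hx, ?_⟩⟩)
        rw [hM, Finset.mem_sdiff, Finset.mem_union, Finset.mem_union]
        exact ⟨hi, fun h => h.elim (fun h => h.elim (fun h => hxE (hAE i x h))
          fun h => hxE (hBE i x h)) hxZ⟩
      have hsum : ∑ i, (G.neighborFinset (v : V) ∩ M i).card ≤ O.card * t + m * (2 * r) := by
        calc ∑ i, (G.neighborFinset (v : V) ∩ M i).card
            ≤ ∑ i : ZMod m, ((if i ∈ O then t else 0) + 2 * r) := by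
              refine Finset.sum_le_sum fun i _ => ?_
              split_ifs with hi
              · have h1 : (G.neighborFinset (v : V) ∩ M i).card ≤ (Q i).card := by
                  refine Finset.card_le_card (Finset.inter_subset_right.trans ?_)
                  rw [hM]
                  exact Finset.sdiff_subset
                rw [(hQc i).card_eq] at h1
                omega
              · simp only [hO, Finset.mem_filter, Finset.mem_univ, true_and] at hi
                omega
          _ = O.card * t + m * (2 * r) := by
              rw [Finset.sum_add_distrib, Finset.sum_ite_mem, Finset.univ_inter, Finset.sum_const,
                Finset.sum_const, Finset.card_univ, ZMod.card, smul_eq_mul, smul_eq_mul]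
      have h1 := Finset.card_le_card hcov
      have h2 := Finset.card_union_le ((U ∪ E) ∪ ZZ)
        (Finset.univ.biUnion fun i => G.neighborFinset (v : V) ∩ M i)
      have h3 := Finset.card_union_le (U ∪ E) ZZ
      have h4 := Finset.card_union_le U E
      have h5 : (Finset.univ.biUnion fun i => G.neighborFinset (v : V) ∩ M i).card ≤
        ∑ i, (G.neighborFinset (v : V) ∩ M i).card := Finset.card_biUnion_le
      rw [SimpleGraph.card_neighborFinset_eq_degree] at h1
      have h6 : G.degree (v : V) ≤ U.card + m * (2 * r) + m * r + (O.card * t + m * (2 * r)) := by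
        omega
      have h7 : (G.degree (v : V) : ℝ) ≤
          U.card + m * (2 * r) + m * r + (O.card * t + m * (2 * r)) := by exact_mod_cast h6
      have h8 := hdeg v
      have h9 : γ * n ≤ 1 / 8 * n := mul_le_mul_of_nonneg_right hγ8 hn0.le
      have h10 : 0 < η * n := by positivity
      -- From a degree above `n / 2`, at most `n / 8` is lost to `U`, and at most `5 r m ≤ n / 8` to
      -- the bridges and to cliques with fewer than `2 r` neighbours.
      have h11 : (n : ℝ) / 4 ≤ O.card * t := by linarith
      have h12 : (W.card : ℝ) ≤ U.card := by
        rw [hW]; exact_mod_cast Finset.card_le_card Finset.sdiff_subset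
      have h13 : (W.card : ℝ) * t ≤ O.card * t := by
        have h14 : (W.card : ℝ) * t ≤ γ * n * t :=
          mul_le_mul_of_nonneg_right (h12.trans hU) ht0.le
        have h15 := mul_le_mul_of_nonneg_right hγt hn0.le
        linarith
      exact_mod_cast le_of_mul_le_mul_right h13 ht0)
  have hMmem : ∀ i x, x ∈ M i ↔ x ∈ Q i ∧ x ∉ A i ∧ x ∉ B i ∧ x ∉ ZZ := by
    intro i x; simp [hM, not_or]
  have hWmem : ∀ x, x ∈ W ↔ x ∈ U ∧ x ∉ ZZ := by
    intro x; rw [hW, Finset.mem_sdiff]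
  have hABM : ∀ i, G.IsClique ((A i ∪ M i ∪ B i : Finset V) : Set V) := by
    intro i
    refine (hQc i).isClique.subset ?_
    intro x hx
    simp only [Finset.coe_union, Set.mem_union, Finset.mem_coe, hMmem] at hx
    rcases hx with (hx | hx) | hx
    exacts [hAQ i hx, hx.1, hBQ i hx]
  have hAM : ∀ i, Disjoint (A i) (M i) := fun i =>
    Finset.disjoint_left.2 fun x hx hx' => ((hMmem i x).1 hx').2.1 hx
  have hMB : ∀ i, Disjoint (M i) (B i) := fun i =>
    Finset.disjoint_left.2 fun x hx hx' => ((hMmem i x).1 hx).2.2.1 hx'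
  have hmid : ∀ i, ∃ mid : List V, mid.Nodup ∧
      (∀ x, x ∈ mid ↔ x ∈ M i ∨ ∃ h : x ∈ W, f ⟨x, h⟩ = i) ∧
      IsPowPath G r ((A i).toList ++ (mid ++ (B i).toList)) := by
    intro i
    by_cases hi : ∃ v, f v = i
    · obtain ⟨v, rfl⟩ := hi
      have hv := hf v
      simp only [Finset.mem_filter, Finset.mem_univ, true_and] at hv
      have hvU := ((hWmem _).1 v.2).1
      obtain ⟨mid, h1, h2, h3⟩ := exists_insertion (hABM (f v)) (hAM _) (hAB _) (hMB _) (v := v)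
        (by
          simp only [Finset.mem_union, hMmem]
          rintro ((h | h) | h)
          exacts [hUQ _ hvU _ (hAQ _ h), hUQ _ hvU _ h.1, hUQ _ hvU _ (hBQ _ h)])
        Finset.inter_subset_right
        (fun x hx => (G.mem_neighborFinset _ _).1 (Finset.mem_of_mem_inter_left hx)) hv
      refine ⟨mid, h1, fun x => (h2 x).trans (or_congr_right ⟨?_, ?_⟩), h3⟩
      · rintro rfl
        exact ⟨v.2, rfl⟩
      · rintro ⟨h, h'⟩
        rw [← hfinj h']
    · refine ⟨(M i).toList, Finset.nodup_toList _, fun x => ?_, (hABM i).isPowPath r ?_ ?_⟩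
      · rw [Finset.mem_toList]
        exact ⟨Or.inl, fun h => h.resolve_right fun ⟨h, h'⟩ => hi ⟨_, h'⟩⟩
      · have h1 := Finset.disjoint_left.1 (hAM i)
        have h2 := Finset.disjoint_left.1 (hMB i)
        have h3 := Finset.disjoint_left.1 (hAB i)
        simp only [List.nodup_append', Finset.nodup_toList, List.disjoint_left,
          Finset.mem_toList, List.mem_append]
        clear * - h1 h2 h3
        grind
      · simp only [List.mem_append, Finset.mem_toList, Finset.coe_union, Set.mem_union,
          Finset.mem_coe]
        clear *-
        grind
  choose mid hmid_nodup hmid_mem hmid_path using hmid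
  have hZmem : ∀ i, Z i ⊆ X i ∧ G.IsClique (Z i : Set V) := fun i => (hZ i (Finset.mem_univ i)).1
  have hZr : ∀ i, (Z i).card = r := fun i => (hZ i (Finset.mem_univ i)).2.1
  have hnodupZ : ∀ i j, ∀ x ∈ Z i, x ∉ A j ∧ x ∉ B j := fun i j x hx =>
    ⟨fun h => hEZ x (hAE j x h) ((hmemZZ x).2 ⟨i, hx⟩),
      fun h => hEZ x (hBE j x h) ((hmemZZ x).2 ⟨i, hx⟩)⟩
  have hmem : ∀ i x, x ∈ (A i).toList ++ (mid i ++ ((B i).toList ++ (Z i).toList)) ↔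
      (x ∈ Q i ∧ x ∉ ZZ) ∨ x ∈ Z i ∨ ∃ h : x ∈ W, f ⟨x, h⟩ = i := by
    intro i x
    have h1 := hMmem i x
    have h2 := fun h => hEZ x (hAE i x h)
    have h3 := fun h => hEZ x (hBE i x h)
    have h4 := @hAQ i x
    have h5 := @hBQ i x
    simp only [List.mem_append, Finset.mem_toList, hmid_mem]
    generalize (∃ h : x ∈ W, f ⟨x, h⟩ = i) = w
    clear * - h1 h2 h3 h4 h5
    grind
  -- Block `i` is `A i, mid i, B i, Z i`. The sets `B i` and `Z i` have exactly `r` elements, just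
  -- enough for the overlaps when gluing.
  refine exists_cyclic_powPath_of_blocks (fun i => (A i).toList)
    (fun i => mid i ++ ((B i).toList ++ (Z i).toList)) (fun i => by simp [hAr]) ?_ ?_ ?_ ?_ ?_
  · exact (hQc 0).isClique.isPowPath r (Finset.nodup_toList _)
      fun x hx => by simpa using hAQ 0 (by simpa using hx)
  · intro i
    have hBi : G.IsClique (B i : Set V) := (hQc i).isClique.subset (by simpa using hBQ i)
    have hAi : G.IsClique (A (i + 1) : Set V) :=
      (hQc (i + 1)).isClique.subset (by simpa using hAQ (i + 1))
    have hBZ := isPowPath_toList_append_toList hBi (hZmem i).2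
      (fun a ha b hb => (hXadj i b ((hZmem i).1 hb)).1 a ha) r
    have hZA := isPowPath_toList_append_toList (hZmem i).2 hAi
      (fun a ha b hb => hXA i a ((hZmem i).1 ha) b hb) r
    have h1 := IsPowPath.glue (by simp [hZr]) hBZ hZA
    have h2 : IsPowPath G r (((A i).toList ++ mid i) ++ (B i).toList) := by
      simpa using hmid_path i
    have h3 := IsPowPath.glue (by simp [hBr]) h2 h1
    simpa using h3
  · intro i
    have h1 := Finset.disjoint_left.1 (hAM i)
    have h2 := Finset.disjoint_left.1 (hMB i)
    have h3 := Finset.disjoint_left.1 (hAB i)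
    have h4 := fun x hx => (hnodupZ i i x hx)
    have h5 : ∀ x ∈ mid i, x ∉ A i ∧ x ∉ B i ∧ x ∉ Z i := by
      intro x hx
      rcases (hmid_mem i x).1 hx with hx | ⟨hx, -⟩
      · exact ⟨fun h => h1 h hx, fun h => h2 hx h, fun h =>
          ((hMmem i x).1 hx).2.2.2 ((hmemZZ x).2 ⟨i, h⟩)⟩
      · have hx' := (hWmem x).1 hx
        exact ⟨fun h => hUQ x hx'.1 i (hAQ i h), fun h => hUQ x hx'.1 i (hBQ i h),
          fun h => hx'.2 ((hmemZZ x).2 ⟨i, h⟩)⟩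
    simp only [List.nodup_append', Finset.nodup_toList, List.disjoint_left, Finset.mem_toList,
      List.mem_append, hmid_nodup]
    clear * - h1 h2 h3 h4 h5
    grind
  · intro a b hne x hxa hxb
    rw [hmem] at hxa hxb
    have h1 := Finset.disjoint_left.1 (hQd a b hne)
    have h2 := Finset.disjoint_left.1 (hZd (Finset.mem_coe.2 (Finset.mem_univ (a : ZMod m)))
      (Finset.mem_coe.2 (Finset.mem_univ (b : ZMod m))) hne)
    have h3 := hUQ x
    have h4 := hWmem x
    have h5 := fun i hi => (hmemZZ x).2 ⟨i, hi⟩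
    rcases hxa with ⟨h, h'⟩ | h | ⟨h, h'⟩ <;> rcases hxb with ⟨g, g'⟩ | g | ⟨g, g'⟩
    · exact h1 h g
    · exact h' (h5 _ g)
    · exact h3 (h4.1 g).1 _ h
    · exact g' (h5 _ h)
    · exact h2 h g
    · exact (h4.1 g).2 (h5 _ h)
    · exact h3 (h4.1 h).1 _ g
    · exact (h4.1 h).2 (h5 _ g)
    · exact hne (h'.symm.trans g')
  · intro x
    have hex : ∃ i : ZMod m, (x ∈ Q i ∧ x ∉ ZZ) ∨ x ∈ Z i ∨ ∃ h : x ∈ W, f ⟨x, h⟩ = i := by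
      by_cases hxZ : x ∈ ZZ
      · obtain ⟨i, hi⟩ := (hmemZZ x).1 hxZ
        exact ⟨i, Or.inr (Or.inl hi)⟩
      by_cases hxU : x ∈ U
      · exact ⟨_, Or.inr (Or.inr ⟨(hWmem x).2 ⟨hxU, hxZ⟩, rfl⟩)⟩
      · obtain ⟨i, hi⟩ := hQU x hxU
        exact ⟨i, Or.inl ⟨hi, hxZ⟩⟩
    obtain ⟨i, hi⟩ := hex
    exact ⟨i, (hmem i x).2 hi⟩

/-! ### The main theorem -/

theorem theorem12 (r s : ℕ) (d η : ℝ) (hd : 0 < d) (hη : 0 < η) :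
    ∃ ρ : ℝ, 0 < ρ ∧ ∃ n₀ : ℕ, 0 < n₀ ∧
      ∀ (V : Type*) [Fintype V] (G : SimpleGraph V) [DecidableRel G.Adj] (n : ℕ),
        Fintype.card V = n → n₀ ≤ n →
        IsLocallyDense G ρ d →
        (1 / 2 + η) * (n : ℝ) ≤ (G.minDegree : ℝ) →
        (graphPower (SimpleGraph.cycleGraph n) r).IsContained G ∧
        ∀ n' : ℕ, n ≤ n' + s → n' ≤ n →
          (graphPower (SimpleGraph.cycleGraph n') r).IsContained G := by
  -- Power `r + 1` covers `r = 0`, where the cycle's own edges are still required; `η / 2` absorbs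
  -- the deletion of up to `s` vertices.
  obtain ⟨t, γ, hγ, hcore⟩ := exists_cyclic_powPath (r + 1) (by omega) (η / 2) (by positivity)
  obtain ⟨ρ, hρ, n₁, hclq⟩ := exists_clique_of_isLocallyDense d hd t (γ / 2) (by positivity)
  -- `2 s ≤ n` gives `n ≤ 2 n'`, which explains `γ / 2`; `⌈2 s / η⌉₊` gives `s ≤ η n / 2`; the final
  -- `1` keeps `n'` positive.
  refine ⟨ρ, hρ, n₁ + 2 * s + ⌈2 * s / η⌉₊ + 1, by omega, ?_⟩
  intro V _ G _ n hn hn₀ hG hdeg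
  classical
  have main : ∀ n' : ℕ, n ≤ n' + s → n' ≤ n →
      (graphPower (SimpleGraph.cycleGraph n') r).IsContained G := by
    intro n' h1 h2
    obtain ⟨Y, -, hY⟩ := Finset.exists_subset_card_eq (s := (Finset.univ : Finset V)) (n := n')
      (by rw [Finset.card_univ, hn]; exact h2)
    set H := G.induce (Y : Set V) with hH
    have hcard : Fintype.card (Y : Set V) = n' := by simp [hY]
    have : Nonempty (Y : Set V) := Fintype.card_pos_iff.1 (by omega)
    have hns : 2 * (s : ℝ) ≤ η * n := by
      have h3 : (2 * s / η : ℝ) ≤ n :=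
        (Nat.le_ceil _).trans (by exact_mod_cast (show ⌈2 * s / η⌉₊ ≤ n by omega))
      rw [div_le_iff₀ hη] at h3
      linarith
    have h1' : (n : ℝ) ≤ n' + s := by exact_mod_cast h1
    have h2' : (n' : ℝ) ≤ n := by exact_mod_cast h2
    have h2s : 2 * (s : ℝ) ≤ n := by exact_mod_cast (show 2 * s ≤ n by omega)
    obtain ⟨l, hl, hmem, hlr, hpath⟩ := hcore (Y : Set V) H (by
      intro v
      rw [hcard]
      have h3 : G.degree (v : V) ≤ H.degree v + s := by
        rw [← SimpleGraph.card_neighborFinset_eq_degree, ← SimpleGraph.card_neighborFinset_eq_degree,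
          ← Finset.card_map (Function.Embedding.subtype _)]
        have h4 : G.neighborFinset (v : V) ⊆
            (H.neighborFinset v).map (Function.Embedding.subtype _) ∪ Yᶜ := by
          intro x hx
          by_cases hxY : x ∈ Y
          · refine Finset.mem_union_left _ (Finset.mem_map.2 ⟨⟨x, hxY⟩, ?_, rfl⟩)
            simpa [hH] using hx
          · simp [hxY]
        have h5 := (Finset.card_le_card h4).trans (Finset.card_union_le _ _)
        rw [Finset.card_compl Y, hY, hn] at h5
        omega
      have h4 : (G.degree (v : V) : ℝ) ≤ H.degree v + s := by exact_mod_cast h3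
      have h5 : (G.minDegree : ℝ) ≤ G.degree (v : V) := by exact_mod_cast G.minDegree_le_degree _
      have h6 : (1 / 2 + η / 2) * (n' : ℝ) ≤ (1 / 2 + η / 2) * n :=
        mul_le_mul_of_nonneg_left h2' (by positivity)
      linarith) (by
      intro X hX
      rw [hcard] at hX
      obtain ⟨C, hC, hCc⟩ := hclq V G (by omega) hG (X.map (Function.Embedding.subtype _)) (by
        rw [Finset.card_map, hn]
        have : γ * (n : ℝ) ≤ γ * (2 * n') := mul_le_mul_of_nonneg_left (by linarith) hγ.le
        linarith)
      obtain ⟨D, hD, rfl⟩ := Finset.subset_map_iff.1 hC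
      refine ⟨D, hD, ?_, by simpa using hCc.card_eq⟩
      intro a ha b hb hab
      exact hCc.isClique (Finset.mem_coe.2 (Finset.mem_map_of_mem _ ha))
        (Finset.mem_coe.2 (Finset.mem_map_of_mem _ hb)) (fun h => hab (Subtype.ext h)))
    have hlen : l.length = n' := by
      rw [← hcard, ← List.toFinset_card_of_nodup hl, ← Finset.card_univ]
      congr 1
      ext x
      simp [hmem]
    have h3 := hpath.isContained_graphPower_cycleGraph hl (by omega) hlr
    rw [hlen] at h3
    exact ((SimpleGraph.IsContained.of_le (graphPower_mono _ (Nat.le_succ r))).trans h3).trans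
      ⟨SimpleGraph.Copy.induce G _⟩
  exact ⟨main n (by omega) le_rfl, main⟩
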